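/- Let $f:\mathbb{R}^n\to\mathbb{R}^n$ have only finitely many equilibria (points $y^*$ with $f(y^*)=0$), let $f$ be continuously differentiable in a neighbourhood of each of them, and suppose that every equilibrium $y^*$ is hyperbolic, i.e. no eigenvalue of the Jacobian matrix $J_C(y^*)$ of $f$ at $y^*$ lies on the imaginary axis. Let $\mathcal{F}$ be the set of all complex eigenvalues of the matrices $J_C(y^*)$, where $y^*$ runs over the (locally) asymptotically stable equilibria of $\frac{dy}{dt}=f(y)$, and put $$\varphi_S:=\min_{\lambda\in\mathcal{F}}\left\{-\frac{2\operatorname{Re}\lambda}{|\lambda|^2}\right\}\qquad(\varphi_S:=+\infty\text{ if }\mathcal{F}=\emptyset).$$ Let $\phi$ be a denominator function: $\phi(\Delta t)>0$ for all $\Delta t>0$, and $\phi(\Delta t)=\Delta t+\mathcal{O}(\Delta t^2)$ as $\Delta t\to0^+$. If $\phi(\Delta t)<\varphi_S$ for all $\Delta t>0$, then for every step size $\Delta t>0$ the nonstandard Euler scheme $$y_{k+1}=y_k+\phi(\Delta t)f(y_k)$$ preserves the local asymptotic stability of the model $\frac{dy}{dt}=f(y)$: the fixed points of the scheme are exactly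 the equilibria of the model, and each of them is asymptotically stable (respectively unstable) for the scheme if and only if it is asymptotically stable (respectively unstable) for the model. -/

import Mathlib

open Set Filter Topology Asymptotics

noncomputable section

/-- The Jacobian matrix `∂fᵢ/∂yⱼ` of a vector field at a point. -/
def jacobianMatrix {n : ℕ} (f : EuclideanSpace ℝ (Fin n) → EuclideanSpace ℝ (Fin n))
    (y : EuclideanSpace ℝ (Fin n)) : Matrix (Fin n) (Fin n) ℝ :=
  Matrix.of fun i j => (fderiv ℝ f y (EuclideanSpace.single j 1)) i

/-- The set of complex eigenvalues of the Jacobian matrix of `f` at `y`. -/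
def jacobianSpectrum {n : ℕ} (f : EuclideanSpace ℝ (Fin n) → EuclideanSpace ℝ (Fin n))
    (y : EuclideanSpace ℝ (Fin n)) : Set ℂ :=
  spectrum ℂ ((jacobianMatrix f y).map (algebraMap ℝ ℂ))

/-- The set of equilibrium points of `y' = f(y)`. -/
def equilibria {n : ℕ} (f : EuclideanSpace ℝ (Fin n) → EuclideanSpace ℝ (Fin n)) :
    Set (EuclideanSpace ℝ (Fin n)) :=
  {y | f y = 0}

/-- The point `y` is hyperbolic: no eigenvalue of the Jacobian lies on the imaginary axis. -/
def IsHyperbolic {n : ℕ} (f : EuclideanSpace ℝ (Fin n) → EuclideanSpace ℝ (Fin n))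
    (y : EuclideanSpace ℝ (Fin n)) : Prop :=
  ∀ z ∈ jacobianSpectrum f y, z.re ≠ 0

/-- Lyapunov stability of `p` for `y' = f(y)`: solutions that start `δ`-close to `p` stay `ε`-close
to `p` as long as they live. All solutions on compact intervals `[0, T]` are considered and not only
those on `[0, ∞)`, so that an equilibrium from which solutions escape to infinity in finite time
does not count as stable. -/
def IsStableODE {n : ℕ} (f : EuclideanSpace ℝ (Fin n) → EuclideanSpace ℝ (Fin n))
    (p : EuclideanSpace ℝ (Fin n)) : Prop :=
  ∀ ε > 0, ∃ δ > 0, ∀ (T : ℝ) (u : ℝ → EuclideanSpace ℝ (Fin n)),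
    IsIntegralCurveOn u (fun _ => f) (Icc 0 T) → ‖u 0 - p‖ < δ → ∀ t ∈ Icc 0 T, ‖u t - p‖ < ε

/-- Local asymptotic stability of `p` for `y' = f(y)`: stable, and solutions that start close
enough to `p` converge to `p`. -/
def IsLASODE {n : ℕ} (f : EuclideanSpace ℝ (Fin n) → EuclideanSpace ℝ (Fin n))
    (p : EuclideanSpace ℝ (Fin n)) : Prop :=
  IsStableODE f p ∧ ∃ δ > 0, ∀ u : ℝ → EuclideanSpace ℝ (Fin n),
    IsIntegralCurveOn u (fun _ => f) (Ici 0) → ‖u 0 - p‖ < δ → Tendsto u atTop (𝓝 p)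

/-- Stability of `p` for the discrete system `y_{k+1} = g(y_k)`. -/
def IsStableMap {n : ℕ} (g : EuclideanSpace ℝ (Fin n) → EuclideanSpace ℝ (Fin n))
    (p : EuclideanSpace ℝ (Fin n)) : Prop :=
  ∀ ε > 0, ∃ δ > 0, ∀ y₀, ‖y₀ - p‖ < δ → ∀ k : ℕ, ‖g^[k] y₀ - p‖ < ε

/-- `p` is attracting for the discrete system `y_{k+1} = g(y_k)`. -/
def IsAttractingMap {n : ℕ} (g : EuclideanSpace ℝ (Fin n) → EuclideanSpace ℝ (Fin n))
    (p : EuclideanSpace ℝ (Fin n)) : Prop :=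
  ∃ η > 0, ∀ y₀, ‖y₀ - p‖ < η → Tendsto (fun k : ℕ => g^[k] y₀) atTop (𝓝 p)

/-- Local asymptotic stability of `p` for the discrete system `y_{k+1} = g(y_k)`. -/
def IsLASMap {n : ℕ} (g : EuclideanSpace ℝ (Fin n) → EuclideanSpace ℝ (Fin n))
    (p : EuclideanSpace ℝ (Fin n)) : Prop :=
  IsStableMap g p ∧ IsAttractingMap g p

/-- A nonstandard denominator function: positive for positive step sizes, and
`φ(h) = h + O(h²)` as `h → 0⁺`. -/
structure IsDenominatorFunction (φ : ℝ → ℝ) : Prop where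
  pos : ∀ h > 0, 0 < φ h
  isBigO : (fun h : ℝ => φ h - h) =O[𝓝[>] 0] (fun h : ℝ => h ^ 2)

/-- One step `y ↦ y + φ(h) f(y)` of the nonstandard Euler scheme with step size `h`. -/
def nonstandardEuler {n : ℕ} (f : EuclideanSpace ℝ (Fin n) → EuclideanSpace ℝ (Fin n))
    (φ : ℝ → ℝ) (h : ℝ) (y : EuclideanSpace ℝ (Fin n)) : EuclideanSpace ℝ (Fin n) :=
  y + φ h • f y

/-- The union of the spectra of the Jacobians at the asymptotically stable equilibria. -/
def stableSpectrum {n : ℕ} (f : EuclideanSpace ℝ (Fin n) → EuclideanSpace ℝ (Fin n)) : Set ℂ :=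
  ⋃ p ∈ {p ∈ equilibria f | IsLASODE f p}, jacobianSpectrum f p

/-- The threshold `φ_S = min (-2 Re z / |z|²)` over `z ∈ stableSpectrum f`. The infimum is taken in
the extended reals: it is a minimum when the (finite) set is nonempty, and `+∞` when it is empty. -/
def stabilityThreshold {n : ℕ} (f : EuclideanSpace ℝ (Fin n) → EuclideanSpace ℝ (Fin n)) : EReal :=
  ⨅ z ∈ stableSpectrum f, ((-(2 * z.re) / ‖z‖ ^ 2 : ℝ) : EReal)

/-- The discrete system `y_{k+1} = g(y_k)` preserves the local asymptotic stability of the model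
`y' = f(y)`: it has the same equilibria, and each of them is asymptotically stable (respectively
unstable) for the discrete system exactly when it is so for the differential equation. -/
def PreservesLAS {n : ℕ} (f g : EuclideanSpace ℝ (Fin n) → EuclideanSpace ℝ (Fin n)) : Prop :=
  Function.fixedPoints g = equilibria f ∧
  ∀ p ∈ equilibria f,
    (IsLASMap g p ↔ IsLASODE f p) ∧ (¬ IsStableMap g p ↔ ¬ IsStableODE f p)

end

/-! Everything follows from linearization at an equilibrium p, with k = φ(h). If all eigenvalues
have negative real part, p is asymptotically stable for the flow, so its spectrum enters the
threshold. Since |1 + kλ|² = 1 + k(2 Re λ + k|λ|²), the bound on k puts all multipliers 1 + kλ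
inside the unit disc, and the scheme is stable too. Otherwise hyperbolicity gives some Re λ > 0,
hence |1 + kλ| > 1 for every k > 0, and p is unstable for both systems.

The four linearization criteria share one device. Two real copies of the system are read as one
complex vector, in a basis where the Jacobian is diagonal up to a small error. The form ∑ sᵢ|zᵢ|²
with sᵢ = ±1 is then a Lyapunov function or, for instability, a Chetaev function: sᵢ = 1 marks the
expanding directions, and a positive value grows exponentially as long as the orbit stays near p. -/

/-! ### Nearly diagonal form of a complex endomorphism -/

/-- Over `ℂ`, every endomorphism of a finite-dimensional space has a basis in which its matrix is
as close to diagonal as desired. -/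
theorem Module.End.exists_basis_nearly_diagonal (n : ℕ) :
    ∀ (V : Type) [AddCommGroup V] [Module ℂ V] [FiniteDimensional ℂ V]
      (_ : Module.finrank ℂ V = n) (T : Module.End ℂ V) (ε : ℝ) (_ : 0 < ε),
      ∃ (b : Module.Basis (Fin n) ℂ V) (l : Fin n → ℂ) (N : Fin n → Fin n → ℂ),
        (∀ μ, T.HasEigenvalue μ ↔ ∃ i, l i = μ) ∧
        (∀ i j, ‖N i j‖ ≤ ε) ∧ ∀ j, T (b j) = l j • b j + ∑ i, N i j • b i := by
  induction n with
  | zero =>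
    intro V _ _ _ hV T ε hε
    have := Module.finrank_zero_iff.1 hV
    refine ⟨Module.finBasisOfFinrankEq ℂ V hV, Fin.elim0, Fin.elim0, ?_, fun i => i.elim0,
      fun i => i.elim0⟩
    intro μ
    refine ⟨fun h => ?_, fun ⟨i, _⟩ => i.elim0⟩
    obtain ⟨v, hv⟩ := h.exists_hasEigenvector
    exact (hv.2 (Subsingleton.elim _ _)).elim
  | succ n ih =>
    intro V _ _ _ hV T ε hε
    have hnt : Nontrivial V := Module.nontrivial_of_finrank_pos (R := ℂ) (by omega)
    obtain ⟨l₀, hl₀⟩ := Module.End.exists_eigenvalue T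
    have hrange : LinearMap.range (T - l₀ • (1 : Module.End ℂ V)) < ⊤ := by
      rw [lt_top_iff_ne_top, Ne, LinearMap.range_eq_top, ← LinearMap.injective_iff_surjective,
        ← LinearMap.ker_eq_bot, ← Module.End.eigenspace_def]
      exact hl₀
    -- A functional vanishing on the range of T - l₀ is an eigenvector of the transpose. Its kernel
    -- is an invariant hyperplane, to which the induction applies.
    obtain ⟨f, hf0, hf⟩ := Submodule.exists_le_ker_of_lt_top _ hrange
    have hfT : ∀ x, f (T x) = l₀ * f x := by
      intro x
      have : f ((T - l₀ • (1 : Module.End ℂ V)) x) = 0 := hf ⟨x, rfl⟩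
      simpa [sub_eq_zero] using this
    obtain ⟨w, hw⟩ : ∃ w, f w = 1 := by
      obtain ⟨w, hw⟩ : ∃ w, f w ≠ 0 := by
        by_contra! h
        exact hf0 (LinearMap.ext h)
      exact ⟨(f w)⁻¹ • w, by simp [hw]⟩
    set H := LinearMap.ker f with hH
    have hTH : ∀ x ∈ H, T x ∈ H := by
      intro x hx
      rw [hH, LinearMap.mem_ker] at hx ⊢
      rw [hfT, hx, mul_zero]
    have hHdim : Module.finrank ℂ H = n := by
      have h1 : Module.finrank ℂ H + 1 = Module.finrank ℂ V :=
        Module.Dual.finrank_ker_add_one_of_ne_zero hf0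
      omega
    obtain ⟨b, l, N, hl, hN, hT⟩ := ih H hHdim (T.restrict hTH) ε hε
    have hh : T w - l₀ • w ∈ H := by
      rw [hH, LinearMap.mem_ker]; simp [hfT, hw]
    set d := b.repr ⟨_, hh⟩ with hd
    have hsum : T w = l₀ • w + ∑ i, d i • (b i : V) := by
      have h1 := congrArg (Subtype.val) (b.sum_repr ⟨_, hh⟩)
      simp only [Submodule.coe_sum, Submodule.coe_smul] at h1
      rw [← hd] at h1
      rw [h1]; abel
    -- Replacing w by s • w multiplies its off-diagonal column d by s, which makes it as small as
    -- required.
    set s : ℝ := ε / (1 + ∑ i, ‖d i‖) with hs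
    have hS : 0 ≤ ∑ i, ‖d i‖ := Finset.sum_nonneg fun _ _ => norm_nonneg _
    have hs0 : 0 < s := by positivity
    have hsd : ∀ i, s * ‖d i‖ ≤ ε := by
      intro i
      have : ‖d i‖ ≤ 1 + ∑ i, ‖d i‖ := by
        have := Finset.single_le_sum (f := fun i => ‖d i‖) (fun _ _ => norm_nonneg _)
          (Finset.mem_univ i)
        linarith
      rw [hs, div_mul_eq_mul_div, div_le_iff₀ (by positivity)]
      gcongr
    have hsC : (s : ℂ) ≠ 0 := by exact_mod_cast hs0.ne'
    have hli : ∀ (c : ℂ), ∀ x ∈ H, c • ((s : ℂ) • w) + x = 0 → c = 0 := by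
      intro c x hx h
      have h2 := congrArg f h
      rw [hH, LinearMap.mem_ker] at hx
      simpa [hw, hx, hsC] using h2
    have hsp : ∀ z : V, ∃ c : ℂ, z + c • ((s : ℂ) • w) ∈ H := by
      intro z
      refine ⟨-(f z) / s, ?_⟩
      rw [hH, LinearMap.mem_ker]
      simp only [map_add, map_smul, hw, smul_eq_mul]
      field_simp
      ring
    refine ⟨Module.Basis.mkFinCons ((s : ℂ) • w) b hli hsp, Fin.cons l₀ l,
      fun i j => Fin.cons (α := fun _ => ℂ) 0
        (fun i' => Fin.cons (α := fun _ => ℂ) ((s : ℂ) * d i') (N i') j) i, ?_, ?_, ?_⟩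
    · intro μ
      constructor
      · intro h
        obtain ⟨v, hv⟩ := h.exists_hasEigenvector
        by_cases hfv : f v = 0
        · have : Module.End.HasEigenvalue (T.restrict hTH) μ := by
            refine Module.End.hasEigenvalue_of_hasEigenvector (x := ⟨v, hfv⟩) ?_
            rw [Module.End.hasEigenvector_iff, Module.End.mem_eigenspace_iff]
            refine ⟨Subtype.ext ?_, fun h0 => hv.2 (congrArg Subtype.val h0)⟩
            simpa using hv.apply_eq_smul
          obtain ⟨i, hi⟩ := (hl μ).1 this
          exact ⟨i.succ, by simpa using hi⟩
        · refine ⟨0, ?_⟩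
          have := hfT v
          rw [hv.apply_eq_smul, map_smul, smul_eq_mul] at this
          simpa using (mul_right_cancel₀ hfv this).symm
      · rintro ⟨i, rfl⟩
        refine Fin.cases ?_ (fun i => ?_) i
        · simpa using hl₀
        · obtain ⟨v, hv⟩ := ((hl (l i)).2 ⟨i, rfl⟩).exists_hasEigenvector
          rw [Fin.cons_succ]
          refine Module.End.hasEigenvalue_of_hasEigenvector (x := (v : V)) ?_
          rw [Module.End.hasEigenvector_iff, Module.End.mem_eigenspace_iff]
          refine ⟨?_, fun h0 => hv.2 (Subtype.ext h0)⟩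
          simpa using congrArg Subtype.val hv.apply_eq_smul
    · intro i j
      refine Fin.cases (by simpa using hε.le) (fun i => ?_) i
      refine Fin.cases ?_ (fun j => ?_) j
      · simpa [abs_of_pos hs0] using hsd i
      · simpa using hN i j
    · intro j
      rw [Module.Basis.coe_mkFinCons, Fin.sum_univ_succ]
      refine Fin.cases ?_ (fun j => ?_) j
      · simp [hsum, smul_add, Finset.smul_sum, smul_smul, mul_comm, -Complex.coe_smul]
      · have := congrArg Subtype.val (hT j)
        simpa using this

/-! ### Complex coordinates near an equilibrium -/

/-- The multiplication operator `z ↦ (lᵢ zᵢ)ᵢ` on `ℂⁿ`. -/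
noncomputable def diagAct {n : ℕ} (l : Fin n → ℂ) (z : EuclideanSpace ℂ (Fin n)) :
    EuclideanSpace ℂ (Fin n) :=
  WithLp.toLp 2 fun i => l i * z i

/-- The identification of pairs of real vectors with complex vectors. -/
noncomputable def pairEquiv (n : ℕ) :
    (EuclideanSpace ℝ (Fin n) × EuclideanSpace ℝ (Fin n)) ≃ₗ[ℝ] (Fin n → ℂ) where
  toFun w i := ⟨w.1 i, w.2 i⟩
  map_add' w w' := by ext i; simp [Complex.ext_iff]
  map_smul' c w := by ext i; simp [Complex.ext_iff]
  invFun z := (WithLp.toLp 2 fun i => (z i).re, WithLp.toLp 2 fun i => (z i).im)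
  left_inv w := by simp
  right_inv z := by simp

/-- The Jacobian has real entries, so its complex action treats real and imaginary parts separately.
-/
theorem pairEquiv_fderiv {n : ℕ} (f : EuclideanSpace ℝ (Fin n) → EuclideanSpace ℝ (Fin n))
    (p : EuclideanSpace ℝ (Fin n)) (w : EuclideanSpace ℝ (Fin n) × EuclideanSpace ℝ (Fin n)) :
    pairEquiv n (fderiv ℝ f p w.1, fderiv ℝ f p w.2) =
      Matrix.toLin' ((jacobianMatrix f p).map (algebraMap ℝ ℂ)) (pairEquiv n w) := by
  have key : ∀ (a : EuclideanSpace ℝ (Fin n)) i,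
      (fderiv ℝ f p a) i = ∑ j, jacobianMatrix f p i j * a j := by
    intro a i
    have ha : a = ∑ j, a j • EuclideanSpace.single j (1 : ℝ) := by
      ext i
      simp [Pi.single_apply]
    conv_lhs => rw [ha]
    simp [jacobianMatrix, mul_comm]
  ext i
  rw [Matrix.toLin'_apply, Matrix.mulVec, dotProduct]
  apply Complex.ext
  · simp [pairEquiv, key]
  · simp [pairEquiv, key]

theorem norm_diag_error_le {n : ℕ} {ε : ℝ} (hε : 0 ≤ ε) (N : Fin n → Fin n → ℂ)
    (hN : ∀ i j, ‖N i j‖ ≤ ε) (z : EuclideanSpace ℂ (Fin n)) :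
    ‖(WithLp.toLp 2 fun i => ∑ j, N i j * z j : EuclideanSpace ℂ (Fin n))‖ ≤
      n * (n * ε) * ‖z‖ := by
  have h1 : ∀ i, ‖∑ j, N i j * z j‖ ≤ n * ε * ‖z‖ := by
    intro i
    refine (norm_sum_le _ _).trans ?_
    calc ∑ j, ‖N i j * z j‖ ≤ ∑ _j : Fin n, ε * ‖z‖ := by
          refine Finset.sum_le_sum fun j _ => ?_
          rw [norm_mul]
          exact mul_le_mul (hN i j) (PiLp.norm_apply_le z j) (norm_nonneg _) hε
      _ = _ := by simp [mul_assoc]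
  refine le_of_sq_le_sq ?_ (by positivity)
  rw [EuclideanSpace.norm_sq_eq]
  refine (Finset.sum_sq_le_sq_sum_of_nonneg fun i _ => norm_nonneg _).trans ?_
  refine pow_le_pow_left₀ (Finset.sum_nonneg fun i _ => norm_nonneg _) ?_ 2
  refine (Finset.sum_le_sum fun i _ => h1 i).trans_eq ?_
  simp [mul_assoc]

/-- Near an equilibrium, in suitable complex coordinates, two copies of a vector field differ from
the diagonal linear field given by the Jacobian eigenvalues by an arbitrarily small relative
error. -/
theorem exists_diagonal_coordinates {n : ℕ}
    {f : EuclideanSpace ℝ (Fin n) → EuclideanSpace ℝ (Fin n)} {p : EuclideanSpace ℝ (Fin n)}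
    (hf : DifferentiableAt ℝ f p) (hp : f p = 0) {ε : ℝ} (hε : 0 < ε) :
    ∃ (Φ : (EuclideanSpace ℝ (Fin n) × EuclideanSpace ℝ (Fin n)) ≃L[ℝ] EuclideanSpace ℂ (Fin n))
      (l : Fin n → ℂ), range l = jacobianSpectrum f p ∧
        ∀ᶠ w in 𝓝 (0 : EuclideanSpace ℝ (Fin n) × EuclideanSpace ℝ (Fin n)),
          ‖Φ (f (p + w.1), f (p + w.2)) - diagAct l (Φ w)‖ ≤ ε * ‖Φ w‖ := by
  set T := Matrix.toLin' ((jacobianMatrix f p).map (algebraMap ℝ ℂ)) with hT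
  -- The off-diagonal part has norm at most n²η ≤ ε/2. The other half of ε is kept for the nonlinear
  -- remainder.
  set η : ℝ := ε / (2 * (n * n + 1)) with hη
  have hη0 : 0 < η := by positivity
  obtain ⟨b, l, N, hl, hN, hb⟩ := Module.End.exists_basis_nearly_diagonal n (Fin n → ℂ)
    (by simp) T η hη0
  let Φ : (EuclideanSpace ℝ (Fin n) × EuclideanSpace ℝ (Fin n)) ≃L[ℝ] EuclideanSpace ℂ (Fin n) :=
    ((pairEquiv n).trans ((b.equivFun.restrictScalars ℝ).trans
      ((WithLp.linearEquiv 2 ℂ (Fin n → ℂ)).symm.restrictScalars ℝ))).toContinuousLinearEquiv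
  have hΦ : ∀ w i, Φ w i = b.repr (pairEquiv n w) i := fun w i => rfl
  refine ⟨Φ, l, ?_, ?_⟩
  · ext μ
    rw [jacobianSpectrum, ← Matrix.spectrum_toLin', ← Module.End.hasEigenvalue_iff_mem_spectrum, hl]
    rfl
  set A := fderiv ℝ f p with hA
  have hlin : ∀ w : EuclideanSpace ℝ (Fin n) × EuclideanSpace ℝ (Fin n),
      ‖Φ (A w.1, A w.2) - diagAct l (Φ w)‖ ≤ ε / 2 * ‖Φ w‖ := by
    intro w
    have h1 : Φ (A w.1, A w.2) - diagAct l (Φ w) =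
        WithLp.toLp 2 fun i => ∑ j, N i j * Φ w j := by
      ext i
      have h2 : pairEquiv n (A w.1, A w.2) = ∑ i, (l i * Φ w i + ∑ j, N i j * Φ w j) • b i := by
        rw [pairEquiv_fderiv, ← hT]
        conv_lhs => rw [← b.sum_repr (pairEquiv n w)]
        simp only [map_sum, map_smul, hb, smul_add, Finset.smul_sum, smul_smul, add_smul,
          Finset.sum_add_distrib, Finset.sum_smul, ← hΦ]
        congr 1
        · simp only [mul_comm]
        · rw [Finset.sum_comm]
          simp only [mul_comm]
      rw [PiLp.sub_apply, hΦ, h2, b.repr_sum_self]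
      simp [diagAct]
    rw [h1]
    refine (norm_diag_error_le hη0.le N hN _).trans ?_
    gcongr
    rw [hη]
    field_simp
    nlinarith
  have hd : HasFDerivAt (fun w : EuclideanSpace ℝ (Fin n) × EuclideanSpace ℝ (Fin n) =>
      (f (p + w.1), f (p + w.2))) (A.prodMap A) 0 := by
    have h1 : HasFDerivAt (fun a => f (p + a)) A 0 := by
      rw [hasFDerivAt_comp_add_left, add_zero]
      exact hf.hasFDerivAt
    exact HasFDerivAt.prodMap (p := (0 : EuclideanSpace ℝ (Fin n) × EuclideanSpace ℝ (Fin n))) h1 h1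
  have ho := (Φ.hasFDerivAt.comp 0 hd).isLittleO
  have ho2 := ho.trans_isBigO (Φ.isBigO_sub_rev _ _)
  filter_upwards [ho2.bound (half_pos hε)] with w hw
  have h3 := hlin w
  simp only [Function.comp_apply, sub_zero, ContinuousLinearMap.comp_apply] at hw
  have h4 : Φ (f (p + w.1), f (p + w.2)) - diagAct l (Φ w) =
      (Φ (f (p + w.1), f (p + w.2)) - Φ (A w.1, A w.2)) + (Φ (A w.1, A w.2) - diagAct l (Φ w)) := by
    abel
  rw [h4]
  refine (norm_add_le _ _).trans ?_
  have h5 : ‖Φ (f (p + w.1), f (p + w.2)) - Φ (A w.1, A w.2)‖ ≤ ε / 2 * ‖Φ w‖ := by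
    have h0 : Φ ((0 : EuclideanSpace ℝ (Fin n)), (0 : EuclideanSpace ℝ (Fin n))) = 0 :=
      map_zero Φ
    simpa [h0, hp, Prod.map] using hw
  linarith

theorem Set.Finite.exists_pos_lower_bound {S : Set ℂ} (hS : S.Finite) {g : ℂ → ℝ}
    (hg : ∀ z ∈ S, 0 < g z) : ∃ c > 0, ∀ z ∈ S, c ≤ g z := by
  rcases S.eq_empty_or_nonempty with rfl | hne
  · exact ⟨1, one_pos, by simp⟩
  · obtain ⟨a, ha, hmin⟩ := Set.exists_min_image S g hS hne
    exact ⟨g a, hg a ha, hmin⟩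

theorem jacobianSpectrum_finite {n : ℕ}
    (f : EuclideanSpace ℝ (Fin n) → EuclideanSpace ℝ (Fin n)) (p : EuclideanSpace ℝ (Fin n)) :
    (jacobianSpectrum f p).Finite := by
  rw [jacobianSpectrum, ← Matrix.spectrum_toLin']
  exact Module.End.finite_spectrum _

/-- `exists_diagonal_coordinates` with the neighbourhood given as a ball in the new coordinates. -/
theorem exists_diagonal_coordinates_ball {n : ℕ}
    {f : EuclideanSpace ℝ (Fin n) → EuclideanSpace ℝ (Fin n)} {p : EuclideanSpace ℝ (Fin n)}
    (hf : DifferentiableAt ℝ f p) (hp : f p = 0) {ε : ℝ} (hε : 0 < ε) :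
    ∃ (Φ : (EuclideanSpace ℝ (Fin n) × EuclideanSpace ℝ (Fin n)) ≃L[ℝ] EuclideanSpace ℂ (Fin n))
      (l : Fin n → ℂ), range l = jacobianSpectrum f p ∧
        ∃ r > 0, ∀ w, ‖Φ w‖ < r →
          ‖Φ (f (p + w.1), f (p + w.2)) - diagAct l (Φ w)‖ ≤ ε * ‖Φ w‖ := by
  obtain ⟨Φ, l, hl, h⟩ := exists_diagonal_coordinates hf hp hε
  refine ⟨Φ, l, hl, ?_⟩
  have h0 : Tendsto Φ.symm (𝓝 0) (𝓝 0) := by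
    simpa using Φ.symm.continuous.tendsto 0
  obtain ⟨r, hr, H⟩ := Metric.eventually_nhds_iff.1 (h0.eventually h)
  refine ⟨r, hr, fun w hw => ?_⟩
  simpa using H (y := Φ w) (by simpa using hw)

/-! ### Signed quadratic forms along solutions -/

/-- The diagonal quadratic form `∑ᵢ sᵢ |zᵢ|²`. -/
noncomputable def diagForm {n : ℕ} (s : Fin n → ℝ) (z : EuclideanSpace ℂ (Fin n)) : ℝ :=
  ∑ i, s i * ‖z i‖ ^ 2

theorem diagForm_le {n : ℕ} {s : Fin n → ℝ} (hs : ∀ i, |s i| ≤ 1)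
    (z : EuclideanSpace ℂ (Fin n)) : diagForm s z ≤ ‖z‖ ^ 2 := by
  rw [EuclideanSpace.norm_sq_eq, diagForm]
  refine Finset.sum_le_sum fun i _ => ?_
  have := (abs_le.1 (hs i)).2
  nlinarith [sq_nonneg ‖z i‖]

theorem diagForm_single {n : ℕ} (s : Fin n → ℝ) (i : Fin n) (a : ℂ) :
    diagForm s (EuclideanSpace.single i a) = s i * ‖a‖ ^ 2 := by
  rw [diagForm, Finset.sum_eq_single i]
  · simp
  · intro j _ hj
    simp [hj]
  · simp

theorem hasDerivWithinAt_diagForm {n : ℕ} (s : Fin n → ℝ) {z : ℝ → EuclideanSpace ℂ (Fin n)}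
    {z' : EuclideanSpace ℂ (Fin n)} {t : ℝ} {S : Set ℝ} (hz : HasDerivWithinAt z z' S t) :
    HasDerivWithinAt (fun t => diagForm s (z t)) (∑ i, s i * (2 * inner ℝ (z t i) (z' i))) S t := by
  unfold diagForm
  refine HasDerivWithinAt.fun_sum fun i _ => HasDerivWithinAt.const_mul _ ?_
  have h : HasDerivWithinAt (fun t => z t i) (z' i) S t :=
    ((EuclideanSpace.proj (𝕜 := ℂ) i).restrictScalars ℝ).hasFDerivAt.comp_hasDerivWithinAt t hz
  exact h.norm_sq

theorem sum_norm_mul_norm_le {n : ℕ} (y z : EuclideanSpace ℂ (Fin n)) :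
    ∑ i, ‖y i‖ * ‖z i‖ ≤ ‖y‖ * ‖z‖ := by
  rw [EuclideanSpace.norm_eq, EuclideanSpace.norm_eq]
  exact Real.sum_mul_le_sqrt_mul_sqrt _ _ _

/-- The right side is the derivative of `diagForm s` along the field y. Since ⟨z, lz⟩ = Re l · |z|²,
the diagonal part contributes at least 2c‖z‖², and Cauchy–Schwarz bounds the error. Taking s = -1
yields decay, s = sign (Re l) yields growth. -/
theorem two_mul_le_sum_inner {n : ℕ} {s : Fin n → ℝ} (hs : ∀ i, |s i| ≤ 1) {l : Fin n → ℂ}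
    {c ε : ℝ} (hc : ∀ i, c ≤ s i * (l i).re) {y z : EuclideanSpace ℂ (Fin n)}
    (hy : ‖y - diagAct l z‖ ≤ ε * ‖z‖) :
    2 * (c - ε) * ‖z‖ ^ 2 ≤ ∑ i, s i * (2 * inner ℝ (z i) (y i)) := by
  set R := y - diagAct l z with hR
  have hyi : ∀ i, y i = l i * z i + R i := by
    intro i; simp [hR, diagAct]
  have h1 : ∀ i, 2 * c * ‖z i‖ ^ 2 - 2 * (‖z i‖ * ‖R i‖) ≤ s i * (2 * inner ℝ (z i) (y i)) := by
    intro i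
    have h2 : inner ℝ (z i) (l i * z i) = (l i).re * ‖z i‖ ^ 2 := by
      rw [Complex.inner, ← Complex.normSq_eq_norm_sq, Complex.normSq_apply]
      simp
      ring
    rw [hyi, inner_add_right, h2]
    have h3 : |s i * inner ℝ (z i) (R i)| ≤ ‖z i‖ * ‖R i‖ := by
      rw [abs_mul]
      calc |s i| * |inner ℝ (z i) (R i)| ≤ 1 * (‖z i‖ * ‖R i‖) :=
            mul_le_mul (hs i) (abs_real_inner_le_norm _ _) (abs_nonneg _) zero_le_one
        _ = _ := one_mul _
    have h4 := (abs_le.1 h3).1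
    have h5 := mul_le_mul_of_nonneg_right (hc i) (sq_nonneg ‖z i‖)
    linarith
  have h6 := Finset.sum_le_sum fun i (_ : i ∈ Finset.univ) => h1 i
  rw [Finset.sum_sub_distrib, ← Finset.mul_sum, ← Finset.mul_sum, ← EuclideanSpace.norm_sq_eq] at h6
  have h7 := sum_norm_mul_norm_le z R
  have h8 := mul_le_mul_of_nonneg_left hy (norm_nonneg z)
  linarith

theorem exists_small_preimage_single {n : ℕ}
    (Φ : (EuclideanSpace ℝ (Fin n) × EuclideanSpace ℝ (Fin n)) ≃L[ℝ] EuclideanSpace ℂ (Fin n))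
    (i : Fin n) {δ : ℝ} (hδ : 0 < δ) :
    ∃ w, ∃ a : ℝ, 0 < a ∧ Φ w = EuclideanSpace.single i (a : ℂ) ∧ ‖w‖ < δ := by
  set v := Φ.symm (EuclideanSpace.single i (1 : ℂ)) with hv
  set a : ℝ := δ / (2 * (‖v‖ + 1)) with ha
  have hv0 := norm_nonneg v
  have ha0 : 0 < a := by positivity
  refine ⟨a • v, a, ha0, ?_, ?_⟩
  · rw [map_smul, hv, Φ.apply_symm_apply]
    ext j
    by_cases hj : j = i <;> simp [hj]
  · rw [norm_smul, Real.norm_of_nonneg ha0.le, ha, div_mul_eq_mul_div, div_lt_iff₀ (by positivity)]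
    nlinarith

theorem IsIntegralCurveOn.hasDerivWithinAt_coordinates {n : ℕ}
    (Φ : (EuclideanSpace ℝ (Fin n) × EuclideanSpace ℝ (Fin n)) ≃L[ℝ] EuclideanSpace ℂ (Fin n))
    {f : EuclideanSpace ℝ (Fin n) → EuclideanSpace ℝ (Fin n)} (p : EuclideanSpace ℝ (Fin n))
    {u v : ℝ → EuclideanSpace ℝ (Fin n)} {S : Set ℝ}
    (hu : IsIntegralCurveOn u (fun _ => f) S) (hv : IsIntegralCurveOn v (fun _ => f) S) {t : ℝ}
    (ht : t ∈ S) :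
    HasDerivWithinAt (fun t => Φ (u t - p, v t - p)) (Φ (f (u t), f (v t))) S t :=
  Φ.hasFDerivAt.comp_hasDerivWithinAt t (((hu t ht).sub_const p).prodMk ((hv t ht).sub_const p))

theorem HasDerivWithinAt.Ici_of_Icc {F : Type*} [NormedAddCommGroup F] [NormedSpace ℝ F]
    {z : ℝ → F} {z' : F} {a b t : ℝ} (ht : t ∈ Ico a b) (h : HasDerivWithinAt z z' (Icc a b) t) :
    HasDerivWithinAt z z' (Ici t) t :=
  h.mono_of_mem_nhdsWithin (Icc_mem_nhdsGE_of_mem ht)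

/-! ### Asymptotic stability for the flow -/

/-- Solutions near an equilibrium whose Jacobian is Hurwitz decay exponentially. -/
theorem exists_exponential_decay_integralCurve {n : ℕ}
    {f : EuclideanSpace ℝ (Fin n) → EuclideanSpace ℝ (Fin n)} {p : EuclideanSpace ℝ (Fin n)}
    (hf : DifferentiableAt ℝ f p) (hp : f p = 0) (hneg : ∀ z ∈ jacobianSpectrum f p, z.re < 0) :
    ∃ C > 0, ∃ c > 0, ∃ r > 0, ∀ a, 0 < a → a ≤ r → ∀ (T : ℝ) (u : ℝ → EuclideanSpace ℝ (Fin n)),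
      IsIntegralCurveOn u (fun _ => f) (Icc 0 T) → ‖u 0 - p‖ < a →
        ∀ t ∈ Icc 0 T, ‖u t - p‖ ^ 2 ≤ C * a ^ 2 * Real.exp (-c * t) := by
  obtain ⟨c, hc0, hc⟩ := (jacobianSpectrum_finite f p).exists_pos_lower_bound
    (g := fun z => -z.re) (fun z hz => neg_pos.2 (hneg z hz))
  obtain ⟨Φ, l, hl, r, hr, hΦ⟩ := exists_diagonal_coordinates_ball hf hp (half_pos hc0)
  obtain ⟨M, hM0, hM⟩ := Φ.toContinuousLinearMap.bound
  obtain ⟨M', hM'0, hM'⟩ := Φ.symm.toContinuousLinearMap.bound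
  refine ⟨M' ^ 2 * M ^ 2, by positivity, c / 2, half_pos hc0, r / (2 * M), by positivity, ?_⟩
  intro a ha har T u hu hu0 t ht
  -- One real copy suffices here; the other rests at the equilibrium.
  have hconst : IsIntegralCurveOn (fun _ => p) (fun _ => f) (Icc 0 T) := by
    intro t _
    simpa [hp] using hasDerivWithinAt_const t (Icc 0 T) p
  set z : ℝ → EuclideanSpace ℂ (Fin n) := fun t => Φ (u t - p, p - p) with hz
  have hzd : ∀ t ∈ Icc 0 T, HasDerivWithinAt z (Φ (f (u t), f p)) (Icc 0 T) t := fun t ht =>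
    hu.hasDerivWithinAt_coordinates Φ p hconst ht
  have hMa : M * a < r := by
    have := mul_le_mul_of_nonneg_left har hM0.le
    have h2 : M * (r / (2 * M)) = r / 2 := by field_simp
    linarith
  have hz0 : ‖z 0‖ ≤ M * a := by
    refine (hM (u 0 - p, p - p)).trans (mul_le_mul_of_nonneg_left ?_ hM0.le)
    simpa using hu0.le
  have hbound : ∀ ⦃t⦄, t ∈ Icc 0 T →
      -diagForm (fun _ => -1) (z t) ≤ (M * a) ^ 2 * Real.exp (-(c / 2) * t) := by
    have hform : ∀ x : EuclideanSpace ℂ (Fin n), -diagForm (fun _ => -1) x = ‖x‖ ^ 2 := by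
      intro x
      simp [diagForm, EuclideanSpace.norm_sq_eq]
    refine image_le_of_deriv_right_lt_deriv_boundary (a := 0) (b := T)
      (f := fun t => -diagForm (fun _ => -1) (z t))
      (f' := fun t => -∑ i, (-1) * (2 * inner ℝ (z t i) (Φ (f (u t), f p) i)))
      (B' := fun t => (M * a) ^ 2 * (Real.exp (-(c / 2) * t) * (-(c / 2))))
      ?_ ?_ ?_ ?_ ?_
    · exact fun t ht => (hasDerivWithinAt_diagForm _ (hzd t ht)).continuousWithinAt.neg
    · exact fun t ht => ((hasDerivWithinAt_diagForm _ (hzd t (Ico_subset_Icc_self ht))).Ici_of_Icc ht).neg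
    · rw [hform]
      simpa using pow_le_pow_left₀ (norm_nonneg _) hz0 2
    · intro t
      have := ((hasDerivAt_id t).const_mul (-(c / 2))).exp.const_mul ((M * a) ^ 2)
      simpa using this
    · intro t ht heq
      rw [hform] at heq
      have hexp : Real.exp (-(c / 2) * t) ≤ 1 := by
        rw [Real.exp_le_one_iff]
        nlinarith [ht.1]
      have hB : 0 < (M * a) ^ 2 * Real.exp (-(c / 2) * t) := by positivity
      -- The comparison only needs the estimate where ‖z‖² meets the barrier, and the barrier lies
      -- below r², so no continuation argument is needed. There ‖z‖² has slope at most -c‖z‖²,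
      -- strictly below the barrier's slope -(c/2)‖z‖².
      have hlt : ‖z t‖ < r := by
        have h1 : ‖z t‖ ^ 2 ≤ (M * a) ^ 2 := by
          rw [heq]
          exact mul_le_of_le_one_right (by positivity) hexp
        exact (le_of_sq_le_sq h1 (by positivity)).trans_lt hMa
      have hest := hΦ (u t - p, p - p) hlt
      simp only [add_sub_cancel] at hest
      have := two_mul_le_sum_inner (s := fun _ : Fin n => (-1 : ℝ)) (by simp) (c := c)
        (fun i => by simpa using hc (l i) (hl ▸ mem_range_self i)) hest
      rw [show Φ (u t - p, p - p) = z t from rfl, heq] at this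
      nlinarith
  have h1 := hbound ht
  have h2 : ‖z t‖ ^ 2 ≤ (M * a) ^ 2 * Real.exp (-(c / 2) * t) := by
    simpa [diagForm, EuclideanSpace.norm_sq_eq] using h1
  have h3 : ‖u t - p‖ ≤ M' * ‖z t‖ := by
    have h4 : ((u t - p, p - p) : EuclideanSpace ℝ (Fin n) × EuclideanSpace ℝ (Fin n)) =
        Φ.symm (z t) := by simp [hz]
    refine (norm_fst_le (u t - p, p - p)).trans ?_
    rw [h4]
    exact hM' (z t)
  calc ‖u t - p‖ ^ 2 ≤ (M' * ‖z t‖) ^ 2 := pow_le_pow_left₀ (norm_nonneg _) h3 2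
    _ = M' ^ 2 * ‖z t‖ ^ 2 := by ring
    _ ≤ M' ^ 2 * ((M * a) ^ 2 * Real.exp (-(c / 2) * t)) := by gcongr
    _ = _ := by ring

theorem isLASODE_of_jacobianSpectrum_re_neg {n : ℕ}
    {f : EuclideanSpace ℝ (Fin n) → EuclideanSpace ℝ (Fin n)} {p : EuclideanSpace ℝ (Fin n)}
    (hf : DifferentiableAt ℝ f p) (hp : f p = 0) (hneg : ∀ z ∈ jacobianSpectrum f p, z.re < 0) :
    IsLASODE f p := by
  obtain ⟨C, hC, c, hc, r, hr, H⟩ := exists_exponential_decay_integralCurve hf hp hneg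
  constructor
  · intro ε hε
    set a := min r (ε / (2 * (C + 1))) with ha
    have ha0 : 0 < a := by positivity
    have haε : a * (2 * (C + 1)) ≤ ε := by
      rw [← le_div_iff₀ (by positivity)]
      exact min_le_right _ _
    refine ⟨a, ha0, fun T u hu hu0 t ht => ?_⟩
    have h1 := H a ha0 (min_le_left _ _) T u hu hu0 t ht
    have hexp : Real.exp (-c * t) ≤ 1 := by
      rw [Real.exp_le_one_iff]
      nlinarith [ht.1]
    refine lt_of_pow_lt_pow_left₀ 2 hε.le ?_
    calc ‖u t - p‖ ^ 2 ≤ C * a ^ 2 * Real.exp (-c * t) := h1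
      _ ≤ C * a ^ 2 := mul_le_of_le_one_right (by positivity) hexp
      _ < (a * (2 * (C + 1))) ^ 2 := by
          have h2 : C < (2 * (C + 1)) ^ 2 := by nlinarith
          rw [mul_pow, mul_comm C]
          exact mul_lt_mul_of_pos_left h2 (by positivity)
      _ ≤ ε ^ 2 := by gcongr
  · refine ⟨r, hr, fun u hu hu0 => ?_⟩
    have h1 : ∀ t ≥ (0 : ℝ), ‖u t - p‖ ^ 2 ≤ C * r ^ 2 * Real.exp (-c * t) := fun t ht =>
      H r hr le_rfl t u (hu.mono Icc_subset_Ici_self) hu0 t ⟨ht, le_rfl⟩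
    have h2 : Tendsto (fun t : ℝ => C * r ^ 2 * Real.exp (-c * t)) atTop (𝓝 0) := by
      have : Tendsto (fun t : ℝ => Real.exp (-c * t)) atTop (𝓝 0) :=
        Real.tendsto_exp_atBot.comp (tendsto_id.const_mul_atTop_of_neg (neg_neg_of_pos hc))
      simpa using this.const_mul (C * r ^ 2)
    have h3 : Tendsto (fun t => ‖u t - p‖ ^ 2) atTop (𝓝 0) :=
      squeeze_zero' (Eventually.of_forall fun _ => by positivity)
        ((eventually_ge_atTop 0).mono h1) h2
    rw [tendsto_iff_norm_sub_tendsto_zero]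
    have h4 := (Real.continuous_sqrt.tendsto 0).comp h3
    simpa [Function.comp_def, Real.sqrt_sq] using h4

/-! ### Instability for the flow -/

/-- A vector field that is `C¹` near a point agrees there with one whose integral curves exist on
arbitrarily long time intervals. -/
theorem ContDiffAt.exists_global_integralCurves {n : ℕ}
    {f : EuclideanSpace ℝ (Fin n) → EuclideanSpace ℝ (Fin n)} {p : EuclideanSpace ℝ (Fin n)}
    (hf : ContDiffAt ℝ 1 f p) :
    ∃ (F : EuclideanSpace ℝ (Fin n) → EuclideanSpace ℝ (Fin n)) (r : ℝ), 0 < r ∧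
      (∀ y, ‖y - p‖ < r → F y = f y) ∧
      ∀ T > 0, ∀ x, ∃ u, u 0 = x ∧ IsIntegralCurveOn u (fun _ => F) (Icc 0 T) := by
  obtain ⟨R, hR, hRf⟩ := Metric.eventually_nhds_iff.1 (hf.eventually (by simp))
  let χ : ContDiffBump p := ⟨R / 4, R / 2, by positivity, by linarith⟩
  have hcont : ContDiff ℝ 1 (fun y => χ y • f y) := by
    rw [contDiff_iff_contDiffAt]
    intro y
    by_cases hy : ‖y - p‖ < R
    · exact χ.contDiffAt.smul (hRf (by rwa [dist_eq_norm]))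
    · have h1 : y ∉ tsupport χ := by
        rw [χ.tsupport_eq]
        simp only [Metric.mem_closedBall, not_le, χ, dist_eq_norm]
        linarith
      have h2 : (fun y => χ y • f y) =ᶠ[𝓝 y] fun _ => 0 := by
        filter_upwards [notMem_tsupport_iff_eventuallyEq.1 h1] with x hx
        simp [hx]
      exact contDiffAt_const.congr_of_eventuallyEq h2
  have hsupp : HasCompactSupport (fun y => χ y • f y) := χ.hasCompactSupport.smul_right
  obtain ⟨K, hK⟩ := hcont.lipschitzWith_of_hasCompactSupport (𝕂 := ℝ) hsupp one_ne_zero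
  obtain ⟨L, hL⟩ := hsupp.exists_bound_of_continuous hcont.continuous
  refine ⟨fun y => χ y • f y, R / 4, by positivity, fun y hy => ?_, fun T hT x => ?_⟩
  · have : χ y = 1 := χ.one_of_mem_closedBall (by
      rw [Metric.mem_closedBall, dist_eq_norm]; exact hy.le)
    simp [this]
  · have hL' : ∀ y, ‖χ y • f y‖ ≤ (L.toNNReal : ℝ) := fun y => (hL y).trans (Real.le_coe_toNNReal L)
    -- A field bounded by L moves a point by at most L·T in time T, so a ball of that radius serves
    -- for every T.
    have hpl : IsPicardLindelof (fun _ y => χ y • f y) (tmin := 0) (tmax := T)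
        ⟨0, le_rfl, hT.le⟩ x (L.toNNReal * T.toNNReal) 0 L.toNNReal K := by
      refine .of_time_independent (fun y _ => hL' y) hK.lipschitzOnWith ?_
      simp [hT.le]
    obtain ⟨u, hu0, hu⟩ := hpl.exists_eq_forall_mem_Icc_hasDerivWithinAt₀
    exact ⟨u, hu0, hu⟩

/-- Stability only constrains solutions that exist. Here it also produces them: a curve of the
truncated field F solves the original equation until it leaves the ball where F = f, and stability
applied up to the first exit time rules out leaving. -/
theorem IsStableODE.exists_integralCurve {n : ℕ}
    {f : EuclideanSpace ℝ (Fin n) → EuclideanSpace ℝ (Fin n)} {p : EuclideanSpace ℝ (Fin n)}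
    (hs : IsStableODE f p) (hf : ContDiffAt ℝ 1 f p) {ε : ℝ} (hε : 0 < ε) :
    ∃ δ > 0, ∀ x, ‖x - p‖ < δ → ∀ T > 0, ∃ u, u 0 = x ∧
      IsIntegralCurveOn u (fun _ => f) (Icc 0 T) ∧ ∀ t ∈ Icc 0 T, ‖u t - p‖ < ε := by
  obtain ⟨F, r, hr, hFf, hF⟩ := hf.exists_global_integralCurves
  set e := min ε (r / 2) with he
  have he0 : 0 < e := by positivity
  have her : e < r := (min_le_right _ _).trans_lt (half_lt_self hr)
  obtain ⟨δ, hδ, H⟩ := hs e he0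
  refine ⟨min δ e, by positivity, fun x hx T hT => ?_⟩
  obtain ⟨u, hu0, hu⟩ := hF T hT x
  have hcont : ContinuousOn (fun t => ‖u t - p‖) (Icc 0 T) := fun t ht =>
    ((hu t ht).continuousWithinAt.sub continuousWithinAt_const).norm
  have hin : ∀ t ∈ Icc 0 T, ‖u t - p‖ < e := by
    by_contra! hcon
    have hcomp : IsCompact (Icc 0 T ∩ (fun t => ‖u t - p‖) ⁻¹' Ici e) :=
      isCompact_Icc.of_isClosed_subset
        (hcont.preimage_isClosed_of_isClosed isClosed_Icc isClosed_Ici) inter_subset_left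
    obtain ⟨t₀, ⟨ht₀, hge⟩, hmin⟩ := hcomp.exists_isLeast (by
      obtain ⟨t, ht, hte⟩ := hcon
      exact ⟨t, ht, hte⟩)
    have hsub : Icc 0 t₀ ⊆ Icc 0 T := Icc_subset_Icc_right ht₀.2
    -- The intermediate value theorem makes the distance exactly e at the exit time t₀, so the curve
    -- is still where F = f at that endpoint.
    have hle : ∀ t ∈ Icc 0 t₀, ‖u t - p‖ ≤ e := by
      obtain ⟨t₁, ht₁, heq⟩ := intermediate_value_Icc ht₀.1 (hcont.mono hsub)
        (show e ∈ Icc ‖u 0 - p‖ ‖u t₀ - p‖ from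
          ⟨by rw [hu0]; exact (hx.trans_le (min_le_right _ _)).le, hge⟩)
      simp only at heq
      have h1 : t₀ = t₁ := le_antisymm (hmin ⟨hsub ht₁, heq.ge⟩) ht₁.2
      intro t ht
      rcases ht.2.lt_or_eq with h | h
      · by_contra! hlt
        exact absurd (hmin ⟨hsub ht, hlt.le⟩) (not_le.2 h)
      · rw [h, h1, heq]
    have hcurve : IsIntegralCurveOn u (fun _ => f) (Icc 0 t₀) := by
      intro t ht
      change HasDerivWithinAt u (f (u t)) _ t
      rw [← hFf _ ((hle t ht).trans_lt her)]
      exact (hu t (hsub ht)).mono hsub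
    exact absurd (H t₀ u hcurve (by rw [hu0]; exact hx.trans_le (min_le_left _ _)) t₀
      ⟨ht₀.1, le_rfl⟩) (not_lt.2 hge)
  refine ⟨u, hu0, fun t ht => ?_, fun t ht => (hin t ht).trans_le (min_le_left _ _)⟩
  change HasDerivWithinAt u (f (u t)) _ t
  rw [← hFf _ ((hin t ht).trans her)]
  exact hu t ht

theorem not_isStableODE_of_exists_re_pos {n : ℕ}
    {f : EuclideanSpace ℝ (Fin n) → EuclideanSpace ℝ (Fin n)} {p : EuclideanSpace ℝ (Fin n)}
    (hf : ContDiffAt ℝ 1 f p) (hp : f p = 0) (hhyp : IsHyperbolic f p)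
    (hpos : ∃ z ∈ jacobianSpectrum f p, 0 < z.re) : ¬ IsStableODE f p := by
  intro hs
  obtain ⟨c, hc0, hc⟩ := (jacobianSpectrum_finite f p).exists_pos_lower_bound
    (g := fun z => |z.re|) (fun z hz => abs_pos.2 (hhyp z hz))
  obtain ⟨Φ, l, hl, r, hr, hΦ⟩ := exists_diagonal_coordinates_ball
    (hf.differentiableAt one_ne_zero) hp (half_pos hc0)
  obtain ⟨i, hi⟩ : ∃ i, 0 < (l i).re := by
    obtain ⟨μ, hμ, hμ0⟩ := hpos
    rw [← hl] at hμ
    obtain ⟨i, rfl⟩ := hμ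
    exact ⟨i, hμ0⟩
  -- By hyperbolicity no sign vanishes, and sᵢ Re lᵢ = |Re lᵢ| ≥ c.
  set s : Fin n → ℝ := fun i => SignType.sign (l i).re with hs_def
  have hs1 : ∀ i, |s i| ≤ 1 := by
    intro i
    rcases lt_trichotomy (l i).re 0 with h | h | h <;> simp [hs_def, h]
  have hsc : ∀ i, c ≤ s i * (l i).re := by
    intro i
    rw [hs_def, sign_mul_self]
    exact hc _ (hl ▸ mem_range_self i)
  obtain ⟨ε, hε, hεr⟩ : ∃ ε > 0, ∀ w, ‖w‖ < ε → ‖Φ w‖ < r := by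
    have h0 : Tendsto Φ (𝓝 0) (𝓝 0) := by simpa using Φ.continuous.tendsto 0
    obtain ⟨ε, hε, H⟩ := Metric.eventually_nhds_iff.1
      (h0.eventually (Metric.ball_mem_nhds _ hr))
    exact ⟨ε, hε, fun w hw => by simpa using H (y := w) (by simpa using hw)⟩
  obtain ⟨δ, hδ, H⟩ := hs.exists_integralCurve hf hε
  -- Starting along an expanding coordinate gives the form the positive initial value a².
  obtain ⟨w, a, ha, hw, hwδ⟩ := exists_small_preimage_single Φ i hδ
  have hgrow : ∀ T > 0, a ^ 2 * Real.exp (c / 2 * T) ≤ r ^ 2 := by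
    intro T hT
    obtain ⟨u, hu0, hu, hue⟩ := H (p + w.1)
      (by simpa using (norm_fst_le w).trans_lt hwδ) T hT
    obtain ⟨v, hv0, hv, hve⟩ := H (p + w.2)
      (by simpa using (norm_snd_le w).trans_lt hwδ) T hT
    set z : ℝ → EuclideanSpace ℂ (Fin n) := fun t => Φ (u t - p, v t - p) with hz
    have hzd : ∀ t ∈ Icc 0 T, HasDerivWithinAt z (Φ (f (u t), f (v t))) (Icc 0 T) t :=
      fun t ht => hu.hasDerivWithinAt_coordinates Φ p hv ht
    have hzr : ∀ t ∈ Icc 0 T, ‖z t‖ < r := fun t ht =>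
      hεr _ (by rw [Prod.norm_def]; exact max_lt (hue t ht) (hve t ht))
    have hz0 : diagForm s (z 0) = a ^ 2 := by
      have : z 0 = Φ w := by simp [hz, hu0, hv0]
      rw [this, hw, diagForm_single]
      simp [hs_def, hi]
    have hbound : ∀ ⦃t⦄, t ∈ Icc 0 T →
        -diagForm s (z t) ≤ -(a ^ 2) * Real.exp (c / 2 * t) := by
      refine image_le_of_deriv_right_lt_deriv_boundary (a := 0) (b := T)
        (f := fun t => -diagForm s (z t))
        (f' := fun t => -∑ i, s i * (2 * inner ℝ (z t i) (Φ (f (u t), f (v t)) i)))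
        (B' := fun t => -(a ^ 2) * (Real.exp (c / 2 * t) * (c / 2)))
        ?_ ?_ ?_ ?_ ?_
      · exact fun t ht => (hasDerivWithinAt_diagForm _ (hzd t ht)).continuousWithinAt.neg
      · exact fun t ht => ((hasDerivWithinAt_diagForm _ (hzd t (Ico_subset_Icc_self ht))).Ici_of_Icc ht).neg
      · rw [hz0]; simp
      · intro t
        have := ((hasDerivAt_id t).const_mul (c / 2)).exp.const_mul (-(a ^ 2))
        simpa using this
      · intro t ht heq
        have hest := hΦ (u t - p, v t - p) (hzr t (Ico_subset_Icc_self ht))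
        simp only [add_sub_cancel] at hest
        have h1 := two_mul_le_sum_inner hs1 hsc hest
        rw [show Φ (u t - p, v t - p) = z t from rfl] at h1
        have h2 := diagForm_le hs1 (z t)
        have hB : 0 < a ^ 2 * Real.exp (c / 2 * t) := by positivity
        nlinarith
    have h1 := hbound (right_mem_Icc.2 hT.le)
    have h2 := diagForm_le hs1 (z T)
    have h3 := pow_le_pow_left₀ (norm_nonneg _) (hzr T (right_mem_Icc.2 hT.le)).le 2
    linarith
  have hlim : Tendsto (fun T : ℝ => a ^ 2 * Real.exp (c / 2 * T)) atTop atTop :=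
    (Real.tendsto_exp_atTop.comp (tendsto_id.const_mul_atTop (half_pos hc0))).const_mul_atTop
      (by positivity)
  obtain ⟨T, hT, hT0⟩ := ((hlim.eventually_gt_atTop (r ^ 2)).and (eventually_gt_atTop 0)).exists
  exact absurd (hgrow T hT0) (not_le.2 hT)

/-! ### Asymptotic stability for the Euler map -/

theorem norm_diagAct_le {n : ℕ} {l : Fin n → ℂ} {c : ℝ} (hc : 0 ≤ c) (hl : ∀ i, ‖l i‖ ≤ c)
    (z : EuclideanSpace ℂ (Fin n)) : ‖diagAct l z‖ ≤ c * ‖z‖ := by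
  refine le_of_sq_le_sq ?_ (by positivity)
  rw [mul_pow, EuclideanSpace.norm_sq_eq, EuclideanSpace.norm_sq_eq, Finset.mul_sum]
  refine Finset.sum_le_sum fun i _ => ?_
  rw [← mul_pow]
  refine pow_le_pow_left₀ (norm_nonneg _) ?_ 2
  simpa [diagAct] using mul_le_mul_of_nonneg_right (hl i) (norm_nonneg (z i))

/-- In the coordinates of `exists_diagonal_coordinates`, an Euler step is nearly the diagonal map
with entries `1 + k lᵢ`. -/
theorem norm_eulerStep_sub_diagAct_le {n : ℕ}
    {Φ : (EuclideanSpace ℝ (Fin n) × EuclideanSpace ℝ (Fin n)) ≃L[ℝ] EuclideanSpace ℂ (Fin n)}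
    {l : Fin n → ℂ} {f : EuclideanSpace ℝ (Fin n) → EuclideanSpace ℝ (Fin n)}
    {p : EuclideanSpace ℝ (Fin n)} {ε r : ℝ}
    (hΦ : ∀ w, ‖Φ w‖ < r → ‖Φ (f (p + w.1), f (p + w.2)) - diagAct l (Φ w)‖ ≤ ε * ‖Φ w‖)
    {k : ℝ} (hk : 0 < k) {a b : EuclideanSpace ℝ (Fin n)} (hr : ‖Φ (a - p, b - p)‖ < r) :
    ‖Φ (a + k • f a - p, b + k • f b - p) - diagAct (fun i => 1 + k * l i) (Φ (a - p, b - p))‖ ≤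
      k * ε * ‖Φ (a - p, b - p)‖ := by
  have h1 := hΦ _ hr
  simp only [add_sub_cancel] at h1
  have h2 : ((a + k • f a - p, b + k • f b - p) :
      EuclideanSpace ℝ (Fin n) × EuclideanSpace ℝ (Fin n)) = (a - p, b - p) + k • (f a, f b) := by
    ext <;> simp <;> ring
  have h3 : Φ (a + k • f a - p, b + k • f b - p) -
      diagAct (fun i => 1 + k * l i) (Φ (a - p, b - p)) =
      k • (Φ (f a, f b) - diagAct l (Φ (a - p, b - p))) := by
    rw [h2, map_add, map_smul]
    ext i
    simp [diagAct]
    ring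
  rw [h3, norm_smul, Real.norm_of_nonneg hk.le, mul_assoc]
  exact mul_le_mul_of_nonneg_left h1 hk.le

theorem isLASMap_euler_of_norm_lt_one {n : ℕ}
    {f : EuclideanSpace ℝ (Fin n) → EuclideanSpace ℝ (Fin n)} {p : EuclideanSpace ℝ (Fin n)}
    (hf : DifferentiableAt ℝ f p) (hp : f p = 0) {k : ℝ} (hk : 0 < k)
    (hlt : ∀ z ∈ jacobianSpectrum f p, ‖1 + k * z‖ < 1) :
    IsLASMap (fun y => y + k • f y) p := by
  obtain ⟨c₀, hc₀, hcS⟩ := (jacobianSpectrum_finite f p).exists_pos_lower_bound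
    (g := fun z => 1 - ‖1 + k * z‖) (fun z hz => sub_pos.2 (hlt z hz))
  -- The cap keeps 1 - c nonnegative even when n = 0, where the spectrum is empty and c₀ is
  -- unconstrained.
  set c := min c₀ 1 with hc_def
  have hc : 0 < c := by positivity
  have hc1 : c ≤ 1 := min_le_right _ _
  -- One step multiplies the field error by k, so c/(2k) becomes c/2 and the contraction factor is
  -- (1 - c) + c/2.
  obtain ⟨Φ, l, hl, r, hr, hΦ⟩ := exists_diagonal_coordinates_ball hf hp
    (ε := c / (2 * k)) (by positivity)
  obtain ⟨M, hM0, hM⟩ := Φ.toContinuousLinearMap.bound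
  obtain ⟨M', hM'0, hM'⟩ := Φ.symm.toContinuousLinearMap.bound
  set g : EuclideanSpace ℝ (Fin n) → EuclideanSpace ℝ (Fin n) := fun y => y + k • f y with hg
  have hlc : ∀ i, ‖1 + k * l i‖ ≤ 1 - c := by
    intro i
    have := hcS (l i) (hl ▸ mem_range_self i)
    have := min_le_left c₀ 1
    linarith
  set q : ℝ := 1 - c / 2 with hq
  have hq0 : 0 ≤ q := by rw [hq]; linarith
  have hq1 : q < 1 := by rw [hq]; linarith
  have hstep : ∀ y, ‖Φ (y - p, p - p)‖ < r →
      ‖Φ (g y - p, p - p)‖ ≤ q * ‖Φ (y - p, p - p)‖ := by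
    intro y hy
    have h1 := norm_eulerStep_sub_diagAct_le hΦ hk hy
    have h2 := norm_diagAct_le (by linarith) hlc (Φ (y - p, p - p))
    have h3 := norm_le_norm_add_norm_sub' (Φ (g y - p, p - p))
      (diagAct (fun i => 1 + k * l i) (Φ (y - p, p - p)))
    have h4 : k * (c / (2 * k)) = c / 2 := by field_simp
    rw [h4, hp, smul_zero, add_zero] at h1
    rw [hq]
    linarith
  have hiter : ∀ y, ‖Φ (y - p, p - p)‖ < r → ∀ m : ℕ,
      ‖Φ (g^[m] y - p, p - p)‖ ≤ q ^ m * ‖Φ (y - p, p - p)‖ := by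
    intro y hy m
    induction m with
    | zero => simp
    | succ m ih =>
      rw [Function.iterate_succ_apply']
      have h1 : ‖Φ (g^[m] y - p, p - p)‖ < r :=
        (ih.trans (mul_le_of_le_one_left (norm_nonneg _) (pow_le_one₀ hq0 hq1.le))).trans_lt hy
      refine (hstep _ h1).trans ?_
      rw [pow_succ', mul_assoc]
      exact mul_le_mul_of_nonneg_left ih hq0
  have hnorm : ∀ y, ‖Φ (y - p, p - p)‖ ≤ M * ‖y - p‖ := by
    intro y
    refine (hM (y - p, p - p)).trans (mul_le_mul_of_nonneg_left ?_ hM0.le)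
    simp
  have hsmall : ∀ y, ‖y - p‖ < r / M → ‖Φ (y - p, p - p)‖ < r := by
    intro y hy
    rw [lt_div_iff₀' hM0] at hy
    exact (hnorm y).trans_lt hy
  have hdecay : ∀ y, ‖y - p‖ < r / M → ∀ m : ℕ,
      ‖g^[m] y - p‖ ≤ M' * (M * ‖y - p‖) * q ^ m := by
    intro y hy m
    have h1 := hM' (Φ (g^[m] y - p, p - p))
    have h2 : Φ.symm.toContinuousLinearMap (Φ (g^[m] y - p, p - p)) = (g^[m] y - p, p - p) :=
      Φ.symm_apply_apply _
    rw [h2] at h1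
    calc ‖g^[m] y - p‖ ≤ ‖(g^[m] y - p, p - p)‖ := norm_fst_le (g^[m] y - p, p - p)
      _ ≤ M' * (q ^ m * (M * ‖y - p‖)) := by
          refine h1.trans (mul_le_mul_of_nonneg_left ?_ hM'0.le)
          refine (hiter y (hsmall y hy) m).trans ?_
          exact mul_le_mul_of_nonneg_left (hnorm y) (by positivity)
      _ = _ := by ring
  constructor
  · intro ε hε
    refine ⟨min (r / M) (ε / (M' * M)), by positivity, fun y hy m => ?_⟩
    have h1 := hdecay y (hy.trans_le (min_le_left _ _)) m
    have h2 := hy.trans_le (min_le_right _ _)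
    rw [lt_div_iff₀' (by positivity)] at h2
    refine (h1.trans (mul_le_of_le_one_right (by positivity) (pow_le_one₀ hq0 hq1.le))).trans_lt ?_
    linarith
  · refine ⟨r / M, by positivity, fun y hy => ?_⟩
    rw [tendsto_iff_norm_sub_tendsto_zero]
    refine squeeze_zero (fun _ => norm_nonneg _) (hdecay y hy) ?_
    simpa using (tendsto_pow_atTop_nhds_zero_of_lt_one hq0 hq1).const_mul (M' * (M * ‖y - p‖))

/-! ### Instability for the Euler map -/

/-- Multipliers on the unit circle are allowed, so coordinates with sᵢ = -1 may gain nothing. The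
gain per coordinate is at least (c/2)(1 + sᵢ)|zᵢ|², which sums to (c/2)(‖z‖² + `diagForm s z`). As
the form is nonnegative, a full (c/2)‖z‖² is left to absorb the errors. -/
theorem add_le_diagForm_of_nearly_diagonal {n : ℕ} {s : Fin n → ℝ} {l : Fin n → ℂ} {c M ε : ℝ}
    (hs : ∀ i, (s i = 1 ∧ 1 + c ≤ ‖l i‖ ^ 2) ∨ (s i = -1 ∧ ‖l i‖ ≤ 1)) (hc : 0 ≤ c)
    (hM : ∀ i, ‖l i‖ ≤ M) (hM0 : 0 ≤ M) {y z : EuclideanSpace ℂ (Fin n)}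
    (hy : ‖y - diagAct l z‖ ≤ ε * ‖z‖) (hz : 0 ≤ diagForm s z) :
    diagForm s z + (c / 2 - 2 * M * ε - ε ^ 2) * ‖z‖ ^ 2 ≤ diagForm s y := by
  set R := y - diagAct l z with hR
  have hyi : ∀ i, y i = l i * z i + R i := by
    intro i; simp [hR, diagAct]
  have h1 : ∀ i, s i * ‖z i‖ ^ 2 + c / 2 * (‖z i‖ ^ 2 + s i * ‖z i‖ ^ 2) -
      2 * M * (‖z i‖ * ‖R i‖) - ‖R i‖ ^ 2 ≤ s i * ‖y i‖ ^ 2 := by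
    intro i
    have h2 : ‖y i‖ ^ 2 = ‖l i‖ ^ 2 * ‖z i‖ ^ 2 + 2 * inner ℝ (l i * z i) (R i) + ‖R i‖ ^ 2 := by
      rw [hyi, norm_add_sq_real, norm_mul, mul_pow]
    have h3 : |inner ℝ (l i * z i) (R i)| ≤ M * (‖z i‖ * ‖R i‖) := by
      refine (abs_real_inner_le_norm _ _).trans ?_
      rw [norm_mul, mul_assoc]
      exact mul_le_mul_of_nonneg_right (hM i) (by positivity)
    obtain ⟨h4, h5⟩ := abs_le.1 h3
    rw [h2]
    rcases hs i with ⟨h, hl⟩ | ⟨h, hl⟩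
    · rw [h]
      have := mul_le_mul_of_nonneg_right hl (sq_nonneg ‖z i‖)
      nlinarith [sq_nonneg ‖R i‖]
    · rw [h]
      have := mul_le_mul_of_nonneg_right (pow_le_one₀ (norm_nonneg _) hl : ‖l i‖ ^ 2 ≤ 1)
        (sq_nonneg ‖z i‖)
      linarith
  have h6 := Finset.sum_le_sum fun i (_ : i ∈ Finset.univ) => h1 i
  rw [Finset.sum_sub_distrib, Finset.sum_sub_distrib, Finset.sum_add_distrib, ← Finset.mul_sum,
    ← Finset.mul_sum, Finset.sum_add_distrib, ← EuclideanSpace.norm_sq_eq,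
    ← EuclideanSpace.norm_sq_eq] at h6
  change diagForm s z + c / 2 * (‖z‖ ^ 2 + diagForm s z) - _ - _ ≤ diagForm s y at h6
  have h7 : ∑ i, ‖z i‖ * ‖R i‖ ≤ ε * ‖z‖ ^ 2 := by
    have := sum_norm_mul_norm_le z R
    have := mul_le_mul_of_nonneg_left hy (norm_nonneg z)
    linarith
  have h8 : ‖R‖ ^ 2 ≤ ε ^ 2 * ‖z‖ ^ 2 := by
    rw [← mul_pow]
    exact pow_le_pow_left₀ (norm_nonneg _) hy 2
  have h9 := mul_le_mul_of_nonneg_left h7 hM0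
  have h10 := mul_nonneg hc hz
  linarith

theorem not_isStableMap_euler_of_exists_one_lt_norm {n : ℕ}
    {f : EuclideanSpace ℝ (Fin n) → EuclideanSpace ℝ (Fin n)} {p : EuclideanSpace ℝ (Fin n)}
    (hf : DifferentiableAt ℝ f p) (hp : f p = 0) {k : ℝ} (hk : 0 < k)
    (hgt : ∃ z ∈ jacobianSpectrum f p, 1 < ‖1 + k * z‖) :
    ¬ IsStableMap (fun y => y + k • f y) p := by
  intro hst
  have hfin := jacobianSpectrum_finite f p
  obtain ⟨c, hc, hcS⟩ :=
    (hfin.subset (sep_subset _ fun z : ℂ => 1 < ‖1 + k * z‖)).exists_pos_lower_bound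
    (g := fun z => ‖1 + k * z‖ ^ 2 - 1) (fun z hz => by nlinarith [hz.2])
  obtain ⟨M, hM⟩ := (hfin.image fun z : ℂ => ‖1 + k * z‖).bddAbove
  have hMS : ∀ z ∈ jacobianSpectrum f p, ‖1 + k * z‖ ≤ M := fun z hz => hM (mem_image_of_mem _ hz)
  have hM0 : 0 ≤ M := by
    obtain ⟨z, hz, -⟩ := hgt
    exact (norm_nonneg _).trans (hMS z hz)
  -- As e ≤ 1, the loss 2Me + e² is at most (2M + 1)e ≤ c/4, leaving growth by the factor 1 + c/4
  -- per step.
  set e := min 1 (c / (4 * (2 * M + 1))) with he_def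
  have he : 0 < e := by positivity
  have he1 : e ≤ 1 := min_le_left _ _
  have hec : 2 * M * e + e ^ 2 ≤ c / 4 := by
    have h1 : e * (4 * (2 * M + 1)) ≤ c := by
      rw [← le_div_iff₀ (by positivity)]
      exact min_le_right _ _
    nlinarith
  obtain ⟨Φ, l, hl, r, hr, hΦ⟩ := exists_diagonal_coordinates_ball hf hp
    (ε := e / k) (by positivity)
  obtain ⟨i, hi⟩ : ∃ i, 1 < ‖1 + k * l i‖ := by
    obtain ⟨μ, hμ, hμ1⟩ := hgt
    rw [← hl] at hμ
    obtain ⟨i, rfl⟩ := hμ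
    exact ⟨i, hμ1⟩
  have hlS : ∀ i, l i ∈ jacobianSpectrum f p := fun i => hl ▸ mem_range_self i
  set s : Fin n → ℝ := fun i => if 1 < ‖1 + k * l i‖ then 1 else -1 with hs_def
  have hs : ∀ i, (s i = 1 ∧ 1 + c ≤ ‖1 + k * l i‖ ^ 2) ∨ (s i = -1 ∧ ‖1 + k * l i‖ ≤ 1) := by
    intro i
    by_cases h : 1 < ‖1 + k * l i‖
    · have := hcS (l i) ⟨hlS i, h⟩
      exact Or.inl ⟨by simp [hs_def, h], by linarith⟩
    · exact Or.inr ⟨by simp [hs_def, h], not_lt.1 h⟩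
  have hs1 : ∀ i, |s i| ≤ 1 := by
    intro i
    rcases hs i with ⟨h, -⟩ | ⟨h, -⟩ <;> simp [h]
  obtain ⟨ε, hε, hεr⟩ : ∃ ε > 0, ∀ w, ‖w‖ < ε → ‖Φ w‖ < r := by
    have h0 : Tendsto Φ (𝓝 0) (𝓝 0) := by simpa using Φ.continuous.tendsto 0
    obtain ⟨ε, hε, H⟩ := Metric.eventually_nhds_iff.1
      (h0.eventually (Metric.ball_mem_nhds _ hr))
    exact ⟨ε, hε, fun w hw => by simpa using H (y := w) (by simpa using hw)⟩
  obtain ⟨δ, hδ, H⟩ := hst ε hε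
  obtain ⟨w, a, ha, hw, hwδ⟩ := exists_small_preimage_single Φ i hδ
  set g : EuclideanSpace ℝ (Fin n) → EuclideanSpace ℝ (Fin n) := fun y => y + k • f y with hg
  have h1 := H (p + w.1) (by simpa using (norm_fst_le w).trans_lt hwδ)
  have h2 := H (p + w.2) (by simpa using (norm_snd_le w).trans_lt hwδ)
  set z : ℕ → EuclideanSpace ℂ (Fin n) := fun m => Φ (g^[m] (p + w.1) - p, g^[m] (p + w.2) - p)
    with hz
  have hzr : ∀ m, ‖z m‖ < r := fun m =>
    hεr _ (by rw [Prod.norm_def]; exact max_lt (h1 m) (h2 m))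
  have hgrow : ∀ m : ℕ, a ^ 2 * (1 + c / 4) ^ m ≤ diagForm s (z m) := by
    intro m
    induction m with
    | zero =>
      have : z 0 = Φ w := by simp [hz]
      rw [this, hw, diagForm_single]
      simp [hs_def, hi]
    | succ m ih =>
      have hpos : 0 ≤ diagForm s (z m) := le_trans (by positivity) ih
      have h3 := norm_eulerStep_sub_diagAct_le hΦ hk (hzr m)
      have h4 : k * (e / k) = e := by field_simp
      rw [h4] at h3
      have h5 := add_le_diagForm_of_nearly_diagonal hs hc.le (fun i => hMS _ (hlS i)) hM0 h3 hpos
      have h6 : z (m + 1) = Φ (g^[m] (p + w.1) + k • f (g^[m] (p + w.1)) - p,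
          g^[m] (p + w.2) + k • f (g^[m] (p + w.2)) - p) := by
        simp only [hz, Function.iterate_succ_apply', hg]
      rw [← h6] at h5
      change diagForm s (z m) + (c / 2 - 2 * M * e - e ^ 2) * ‖z m‖ ^ 2 ≤ _ at h5
      have h7 := diagForm_le hs1 (z m)
      have h8 : c / 4 * ‖z m‖ ^ 2 ≤ (c / 2 - 2 * M * e - e ^ 2) * ‖z m‖ ^ 2 :=
        mul_le_mul_of_nonneg_right (by linarith) (sq_nonneg _)
      have h9 : c / 4 * diagForm s (z m) ≤ c / 4 * ‖z m‖ ^ 2 :=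
        mul_le_mul_of_nonneg_left h7 (by positivity)
      have h10 := mul_le_mul_of_nonneg_right ih (by positivity : (0 : ℝ) ≤ 1 + c / 4)
      rw [pow_succ (1 + c / 4), ← mul_assoc]
      linarith
  have hlim : Tendsto (fun m : ℕ => a ^ 2 * (1 + c / 4) ^ m) atTop atTop :=
    (tendsto_pow_atTop_atTop_of_one_lt (by linarith)).const_mul_atTop (by positivity)
  obtain ⟨m, hm⟩ := (hlim.eventually_gt_atTop (r ^ 2)).exists
  have h3 := diagForm_le hs1 (z m)
  have h4 := pow_le_pow_left₀ (norm_nonneg _) (hzr m).le 2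
  have h5 := hgrow m
  linarith

/-! ### Multipliers of the scheme and conclusion -/

theorem norm_one_add_mul_lt_one {z : ℂ} (hz : z ≠ 0) {k : ℝ} (hk : 0 < k)
    (hkz : k < -(2 * z.re) / ‖z‖ ^ 2) : ‖1 + k * z‖ < 1 := by
  have h0 : 0 < ‖z‖ ^ 2 := by positivity
  rw [lt_div_iff₀ h0] at hkz
  refine lt_of_pow_lt_pow_left₀ 2 zero_le_one ?_
  have h1 : ‖1 + k * z‖ ^ 2 = 1 + k * (2 * z.re + k * ‖z‖ ^ 2) := by
    rw [← Complex.normSq_eq_norm_sq, ← Complex.normSq_eq_norm_sq, Complex.normSq_apply,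
      Complex.normSq_apply]
    simp
    ring
  rw [h1]
  nlinarith

theorem one_lt_norm_one_add_mul {z : ℂ} (hz : 0 < z.re) {k : ℝ} (hk : 0 < k) :
    1 < ‖1 + k * z‖ := by
  refine lt_of_lt_of_le ?_ (Complex.re_le_norm _)
  simpa using mul_pos hk hz

theorem corollary4p12 (n : ℕ) (f : EuclideanSpace ℝ (Fin n) → EuclideanSpace ℝ (Fin n))
    (hf : ∀ p ∈ equilibria f, ContDiffAt ℝ 1 f p)
    (hfin : (equilibria f).Finite)
    (hhyp : ∀ p ∈ equilibria f, IsHyperbolic f p)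
    (φ : ℝ → ℝ) (hφ : IsDenominatorFunction φ)
    (hφS : ∀ h > 0, (φ h : EReal) < stabilityThreshold f) :
    ∀ h > 0, PreservesLAS f (nonstandardEuler f φ h) := by
  intro h hh
  have hk := hφ.pos h hh
  refine ⟨?_, fun p hp => ?_⟩
  · ext y
    simp [Function.IsFixedPt, nonstandardEuler, equilibria, hk.ne']
  have hd := (hf p hp).differentiableAt one_ne_zero
  by_cases hneg : ∀ z ∈ jacobianSpectrum f p, z.re < 0
  · have hode := isLASODE_of_jacobianSpectrum_re_neg hd hp hneg
    have hmap : IsLASMap (nonstandardEuler f φ h) p := by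
      refine isLASMap_euler_of_norm_lt_one hd hp hk fun z hz => ?_
      -- Stability for the flow, just established, is what makes the threshold apply to the
      -- eigenvalues at p.
      have hzS : z ∈ stableSpectrum f := mem_biUnion (show p ∈ _ from ⟨hp, hode⟩) hz
      have hlt := (hφS h hh).trans_le (iInf₂_le z hzS)
      refine norm_one_add_mul_lt_one ?_ hk (EReal.coe_lt_coe_iff.1 hlt)
      rintro rfl
      exact absurd (hneg 0 hz) (by simp)
    exact ⟨iff_of_true hmap hode, not_congr (iff_of_true hmap.1 hode.1)⟩
  · push Not at hneg
    obtain ⟨z, hz, hz0⟩ := hneg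
    have hpos : 0 < z.re := lt_of_le_of_ne hz0 (hhyp p hp z hz).symm
    have hode := not_isStableODE_of_exists_re_pos (hf p hp) hp (hhyp p hp) ⟨z, hz, hpos⟩
    have hmap : ¬ IsStableMap (nonstandardEuler f φ h) p :=
      not_isStableMap_euler_of_exists_one_lt_norm hd hp hk ⟨z, hz, one_lt_norm_one_add_mul hpos hk⟩
    exact ⟨iff_of_false (fun H => hmap H.1) (fun H => hode H.1), iff_of_true hmap hode⟩
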